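/- A \emph{sequential transducer} is a tuple $T=(Q,\Sigma,\Gamma,\delta)$, where $Q$ is a finite nonempty set of states, $\Sigma$ is a finite input alphabet, $\Gamma$ is a finite output alphabet, and $\delta\colon Q\times\Sigma\to Q\times\Gamma^*$ is a total transition function (start and final states are irrelevant here and omitted). The function $\delta$ is extended to input words by concatenating the outputs: $\delta(q,\epsilon)=(q,\epsilon)$, and if $\delta(q,\sigma)=(q',\gamma_1)$ and $\delta(q',w)=(q'',\gamma_2)$ with $\sigma\in\Sigma$, $w\in\Sigma^*$, then $\delta(q,\sigma w)=(q'',\gamma_1\gamma_2)$. A word $w\in\Sigma^*$ \emph{trace-synchronizes} $T$ if $\delta(p,w)=\delta(q,w)$ for all $p,q\in Q$, that is, $w$ brings all states of $T$ to the same state and produces the same output on all states. \textbf{Theorem.} The following problem (Trace-Sync-Transducer) is undecidable: given a sequential transducer $T=(Q,\Sigma,\Gamma,\delta)$ (as a finite list of its transitions), does there exist a word $w\in\Sigma^*$ that trace-synchronizes $T$? That is, no algorithm, given an arbitrary sequential transducer, correctly decides whether it has a trace-synchronizing word. -/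

import Mathlib

/-- A sequential transducer with finite state set `Q`, finite input alphabet `A` and finite output
alphabet `B` (start and final states play no role for synchronization and are left out): a total
transition function assigning to a state and an input letter the next state and an output word. -/
structure SequentialTransducer (Q A B : Type*) [Finite Q] [Finite A] [Finite B] where
  step : Q → A → Q × List B

namespace SequentialTransducer

/-- The transition function extended to input words, concatenating the produced outputs. -/
def run {Q A B : Type*} [Finite Q] [Finite A] [Finite B] (T : SequentialTransducer Q A B) :
    Q → List A → Q × List B
  | q, [] => (q, [])
  | q, a :: w =>
    ((T.run (T.step q a).1 w).1, (T.step q a).2 ++ (T.run (T.step q a).1 w).2)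

/-- The word `w` brings all states to the same state and produces the same output on all states. -/
def TraceSynchronizes {Q A B : Type*} [Finite Q] [Finite A] [Finite B]
    (T : SequentialTransducer Q A B) (w : List A) : Prop :=
  ∀ p q : Q, T.run p w = T.run q w

end SequentialTransducer

/-- The tuple `(n, k, m, L)` is the description of a sequential transducer with states
`0, ..., n - 1` (at least one), input letters `0, ..., k - 1` and output letters `0, ..., m - 1`.
The list `L` is its transition table: the entry at position `q * k + a` is the pair
(next state, output word) for the state `q` and the letter `a`. -/
def IsTransducerDescription (c : ℕ × ℕ × ℕ × List (ℕ × List ℕ)) : Prop :=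
  0 < c.1 ∧ c.2.2.2.length = c.1 * c.2.1 ∧
    ∀ e ∈ c.2.2.2, e.1 < c.1 ∧ ∀ b ∈ e.2, b < c.2.2.1

instance IsTransducerDescription.decidablePred : DecidablePred IsTransducerDescription :=
  fun _ => inferInstanceAs (Decidable (_ ∧ _ ∧ _))

theorem IsTransducerDescription.primrecPred : PrimrecPred IsTransducerDescription := by
  have hR : PrimrecRel fun (e : ℕ × List ℕ) (c : ℕ × ℕ × ℕ × List (ℕ × List ℕ)) =>
      e.1 < c.1 ∧ ∀ b ∈ e.2, b < c.2.2.1 := by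
    refine PrimrecPred.and
      (p := fun x : (ℕ × List ℕ) × (ℕ × ℕ × ℕ × List (ℕ × List ℕ)) => x.1.1 < x.2.1)
      (q := fun x => ∀ b ∈ x.1.2, b < x.2.2.2.1) ?_ ?_
    · exact Primrec.nat_lt.comp (Primrec.fst.comp Primrec.fst) (Primrec.fst.comp Primrec.snd)
    · exact Primrec.nat_lt.forall_mem_list.comp (Primrec.snd.comp Primrec.fst)
        (Primrec.fst.comp (Primrec.snd.comp (Primrec.snd.comp Primrec.snd)))
  have hL : Primrec fun c : ℕ × ℕ × ℕ × List (ℕ × List ℕ) => c.2.2.2 :=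
    Primrec.snd.comp (Primrec.snd.comp Primrec.snd)
  refine (Primrec.nat_lt.comp (Primrec.const 0) Primrec.fst).and (PrimrecPred.and ?_ ?_)
  · exact Primrec.eq.comp (Primrec.list_length.comp hL)
      (Primrec.nat_mul.comp Primrec.fst (Primrec.fst.comp Primrec.snd))
  · exact hR.forall_mem_list.comp hL Primrec.id

/-- The instances of the trace-synchronization problem: finite descriptions of transducers. -/
abbrev TransducerDescription : Type :=
  {c : ℕ × ℕ × ℕ × List (ℕ × List ℕ) // IsTransducerDescription c}

instance TransducerDescription.primcodable : Primcodable TransducerDescription :=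
  Primcodable.subtype IsTransducerDescription.primrecPred

namespace TransducerDescription

/-- The number of states. -/
def numStates (c : TransducerDescription) : ℕ := c.1.1

/-- The number of input letters. -/
def numInputs (c : TransducerDescription) : ℕ := c.1.2.1

/-- The number of output letters. -/
def numOutputs (c : TransducerDescription) : ℕ := c.1.2.2.1

/-- The transition table. -/
def table (c : TransducerDescription) : List (ℕ × List ℕ) := c.1.2.2.2

theorem index_lt (c : TransducerDescription) (q : Fin c.numStates) (a : Fin c.numInputs) :
    q.1 * c.numInputs + a.1 < c.table.length := by
  have h : c.table.length = c.numStates * c.numInputs := c.2.2.1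
  rw [h]
  calc q.1 * c.numInputs + a.1 < q.1 * c.numInputs + c.numInputs := by omega
    _ = (q.1 + 1) * c.numInputs := by ring
    _ ≤ c.numStates * c.numInputs := Nat.mul_le_mul_right _ q.2

/-- The table entry for the state `q` and the input letter `a`. -/
def entry (c : TransducerDescription) (q : Fin c.numStates) (a : Fin c.numInputs) :
    ℕ × List ℕ :=
  c.table[q.1 * c.numInputs + a.1]'(c.index_lt q a)

theorem entry_lt (c : TransducerDescription) (q : Fin c.numStates) (a : Fin c.numInputs) :
    (c.entry q a).1 < c.numStates ∧ ∀ b ∈ (c.entry q a).2, b < c.numOutputs :=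
  c.2.2.2 _ (List.getElem_mem _)

/-- The sequential transducer with the given description. -/
def toTransducer (c : TransducerDescription) :
    SequentialTransducer (Fin c.numStates) (Fin c.numInputs) (Fin c.numOutputs) where
  step q a :=
    (⟨(c.entry q a).1, (c.entry_lt q a).1⟩,
      (c.entry q a).2.attach.map fun b => ⟨b.1, (c.entry_lt q a).2 b.1 b.2⟩)

end TransducerDescription

/-- The decision problem Trace-Sync-Transducer: given (the description of) a sequential
transducer, does there exist an input word that trace-synchronizes it? -/
def TraceSyncTransducer (c : TransducerDescription) : Prop :=
  ∃ w : List (Fin c.numInputs), c.toTransducer.TraceSynchronizes w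

/-! The halting problem is reduced to trace synchronization through queue machines. In the
transducer built from such a machine, the leader never leaves its state, copies symbols, and never
prints `finish`. From `idle`, any first letter other than `mark` prints `finish`, so a synchronizing
word begins with `mark`, which sends every non-leader state to `track q₀` and makes it print the
initial queue. From then on the follower's output is ahead of the leader's by exactly the queue
contents. To keep the outputs compatible, the input must spell the letters that the queue machine
removes, so the word is forced to follow its computation. A follower that has not halted can join
the leader only by printing `finish`; hence the outputs can agree only if the machine halts.
Conversely, a halting run yields a synchronizing word. This is `exists_traceSynchronizes_iff`.

Queue machines are universal: the stacks of a `TM2` machine are laid out cyclically on the queue,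
and an operation on a stack rotates the queue until its separator is in front
(`exists_reaches₁_stepAux`). Only the initial queue depends on the argument, and it does so
primitive recursively, so the transducer is computable from the instance. -/

/-! ### Queue machines and their halting. -/

/-- A deterministic queue machine: in a state it removes the first letter of its queue, changes
state and appends a word at the end of the queue. -/
structure QueueMachine (Q A : Type*) where
  step : Q → A → Q × List A
  halted : Q → Bool

namespace QueueMachine

variable {Q A : Type*} (M : QueueMachine Q A)

/-- One step on configurations; there is none on an empty queue or in a halted state. -/
def next : Q × List A → Option (Q × List A)
  | (_, []) => none
  | (q, a :: l) => if M.halted q then none else some ((M.step q a).1, l ++ (M.step q a).2)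

/-- The machine reaches a halted state. -/
def HaltsFrom (c : Q × List A) : Prop :=
  ∃ d, StateTransition.Reaches M.next c d ∧ M.halted d.1

variable {M}

theorem next_cons {q : Q} (h : M.halted q = false) (a : A) (l : List A) :
    M.next (q, a :: l) = some ((M.step q a).1, l ++ (M.step q a).2) := by
  simp [next, h]

theorem next_of_halted {q : Q} (h : M.halted q) (l : List A) : M.next (q, l) = none := by
  cases l <;> simp [next, h]

theorem HaltsFrom.of_next {c d : Q × List A} (h : M.next c = some d) (hd : M.HaltsFrom d) :
    M.HaltsFrom c := by
  obtain ⟨e, he, hh⟩ := hd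
  exact ⟨e, he.head h, hh⟩

variable (M) in
/-- The restriction of a queue machine to a set of states closed under its steps. -/
def restrict (F : Set Q) (hF : ∀ q ∈ F, ∀ a, (M.step q a).1 ∈ F) : QueueMachine F A where
  step q a := (⟨(M.step q a).1, hF q q.2 a⟩, (M.step q a).2)
  halted q := M.halted q

/-- The inclusion of states is a simulation step for step. It is needed because the simulating
machine has infinitely many states, of which a finite closed set suffices. -/
theorem restrict_haltsFrom {F : Set Q} (hF : ∀ q ∈ F, ∀ a, (M.step q a).1 ∈ F)
    (q : F) (l : List A) : (M.restrict F hF).HaltsFrom (q, l) ↔ M.HaltsFrom (q.1, l) := by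
  have key : ∀ (c : F × List A), M.next (c.1.1, c.2) =
      ((M.restrict F hF).next c).map fun d => (d.1.1, d.2) := by
    rintro ⟨q, _ | ⟨a, l⟩⟩
    · rfl
    · by_cases h : M.halted q <;> simp [next, restrict, h]
  have hR : StateTransition.Respects (M.restrict F hF).next M.next
      fun c d => (c.1.1, c.2) = d := by
    rintro c _ rfl
    have := key c
    cases h : (M.restrict F hF).next c with
    | none => simpa [h] using this
    | some d => exact ⟨_, rfl, .single (by simp [this, h])⟩
  constructor
  · rintro ⟨d, hd, hh⟩
    obtain ⟨_, rfl, h⟩ := StateTransition.tr_reaches hR rfl hd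
    exact ⟨_, h, hh⟩
  · rintro ⟨d, hd, hh⟩
    obtain ⟨c₁, c₂, h₁, rfl, h₂⟩ := StateTransition.tr_reaches_rev hR
      (show ((q, l).1.1, (q, l).2) = (q.1, l) from rfl) hd
    -- The simulation only gives a configuration reachable from `d`; as `d` is halted, it is `d`
    -- itself.
    have : d = (c₁.1.1, c₁.2) := by
      rcases h₁.cases_head with h | ⟨e, he, -⟩
      · exact h
      · rw [show d = (d.1, d.2) from rfl, next_of_halted hh] at he
        cases he
    subst this
    exact ⟨c₁, h₂, hh⟩

end QueueMachine

/-! ### From queue machines to synchronization. -/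

/-- The letters of the synchronization transducers: symbols, a start signal and a final signal. -/
inductive SyncLetter (A : Type*)
  | sym (a : A)
  | mark
  | finish

/-- The states of the synchronization transducers: the leader copies its input, a follower tracks
a queue machine, and the idle state expects the start signal. -/
inductive SyncState (Q : Type*)
  | leader
  | idle
  | track (q : Q)

instance SyncLetter.finite {A : Type*} [Finite A] : Finite (SyncLetter A) :=
  Finite.of_surjective (fun x : Option (Option A) => match x with
    | none => SyncLetter.mark
    | some none => .finish
    | some (some a) => .sym a) (by
      rintro (a | _ | _)
      exacts [⟨some (some a), rfl⟩, ⟨none, rfl⟩, ⟨some none, rfl⟩])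

instance SyncState.finite {Q : Type*} [Finite Q] : Finite (SyncState Q) :=
  Finite.of_surjective (fun x : Option (Option Q) => match x with
    | none => SyncState.leader
    | some none => .idle
    | some (some q) => .track q) (by
      rintro (_ | _ | q)
      exacts [⟨none, rfl⟩, ⟨some none, rfl⟩, ⟨some (some q), rfl⟩])

namespace QueueMachine

open SyncState SyncLetter

variable {Q A : Type*} (M : QueueMachine Q A)

/-- The transition of the synchronization transducer for a queue machine started in the state `q₀`,
without the initial queue, and whether the initial queue has to be added to the output. -/
def syncEntry (q₀ : Q) : SyncState Q → SyncLetter A → SyncState Q × List (SyncLetter A) × Bool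
  | leader, sym a => (leader, [sym a], false)
  | leader, _ => (leader, [mark], false)
  | idle, mark => (track q₀, [mark], true)
  | idle, _ => (leader, [finish], false)
  | track q, sym a =>
    if M.halted q then (track q, [], false)
    else (track (M.step q a).1, (M.step q a).2.map sym, false)
  | track _, mark => (track q₀, [mark], true)
  | track q, finish => (leader, [if M.halted q then mark else finish], false)

variable [Finite Q] [Finite A]

/-- The synchronization transducer for a queue machine with an initial configuration. -/
def syncTransducer (q₀ : Q) (l₀ : List A) :
    SequentialTransducer (SyncState Q) (SyncLetter A) (SyncLetter A) where
  step p x := ((M.syncEntry q₀ p x).1, (M.syncEntry q₀ p x).2.1 ++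
    bif (M.syncEntry q₀ p x).2.2 then l₀.map sym else [])

variable {M} {q₀ : Q} {l₀ : List A}

open SequentialTransducer

theorem run_syncTransducer_cons (p : SyncState Q) (x : SyncLetter A) (w : List (SyncLetter A)) :
    (M.syncTransducer q₀ l₀).run p (x :: w) =
      (((M.syncTransducer q₀ l₀).run (M.syncEntry q₀ p x).1 w).1,
        ((M.syncEntry q₀ p x).2.1 ++ bif (M.syncEntry q₀ p x).2.2 then l₀.map sym else []) ++
          ((M.syncTransducer q₀ l₀).run (M.syncEntry q₀ p x).1 w).2) := rfl

theorem run_leader_fst (w : List (SyncLetter A)) :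
    ((M.syncTransducer q₀ l₀).run leader w).1 = leader := by
  induction w with
  | nil => rfl
  | cons x w ih => cases x <;> simpa [run_syncTransducer_cons, syncEntry] using ih

theorem finish_notMem_run_leader (w : List (SyncLetter A)) :
    finish ∉ ((M.syncTransducer q₀ l₀).run leader w).2 := by
  induction w with
  | nil => simp [run]
  | cons x w ih => cases x <;> simpa [run_syncTransducer_cons, syncEntry] using ih

/-- If the leader, behind by the queue contents, catches up with the follower, then the queue machine
halts on its current or on its initial configuration. The letter `b` prevents the queue from running
empty. -/
theorem haltsFrom_of_run_eq {b : A} (hb : ∀ q, b ∈ (M.step q b).2) (hl₀ : b ∈ l₀)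
    (w : List (SyncLetter A)) (q : Q) (l : List A)
    (h₁ : ((M.syncTransducer q₀ l₀).run (track q) w).1 = leader)
    (h₂ : ((M.syncTransducer q₀ l₀).run leader w).2 =
      l.map sym ++ ((M.syncTransducer q₀ l₀).run (track q) w).2) (hl : b ∈ l) :
    M.HaltsFrom (q, l) ∨ M.HaltsFrom (q₀, l₀) := by
  by_cases hq : M.halted q
  · exact Or.inl ⟨_, .refl, hq⟩
  induction w generalizing q l with
  | nil => simp [run] at h₁
  | cons x w ih =>
    have ih' : ∀ q l, ((M.syncTransducer q₀ l₀).run (track q) w).1 = leader →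
        ((M.syncTransducer q₀ l₀).run leader w).2 =
          l.map sym ++ ((M.syncTransducer q₀ l₀).run (track q) w).2 → b ∈ l →
        M.HaltsFrom (q, l) ∨ M.HaltsFrom (q₀, l₀) := fun q l h h' hl => by
      by_cases hq : M.halted q
      · exact Or.inl ⟨_, .refl, hq⟩
      · exact ih q l h h' hl hq
    cases x with
    | sym a =>
      simp only [run_syncTransducer_cons, syncEntry, hq] at h₁ h₂
      -- The leader prints `a` now, so `a` must be the front of the queue: reading it is a step of
      -- the queue machine.
      cases l with
      | nil => simp at hl
      | cons c l =>
        simp only [Bool.not_eq_true] at hq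
        simp at h₁ h₂
        obtain ⟨rfl, h₂⟩ := h₂
        refine (ih' _ (l ++ (M.step q a).2) h₁ (by simpa using h₂) ?_).imp_left
          (.of_next (next_cons hq _ _))
        rcases List.mem_cons.1 hl with rfl | hl
        · exact List.mem_append_right _ (hb q)
        · exact List.mem_append_left _ hl
    | mark =>
      simp only [run_syncTransducer_cons, syncEntry] at h₁ h₂
      -- A restart would need an empty queue, since otherwise the follower's lead begins with a
      -- symbol and not with `mark`.
      cases l with
      | nil => exact Or.inr (or_self_iff.1 (ih' q₀ l₀ h₁ (by simpa using h₂) hl₀))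
      | cons b l => simp at h₂
    | finish =>
      -- A follower that has not halted prints `finish` here, which the leader never prints.
      have := finish_notMem_run_leader (M := M) (q₀ := q₀) (l₀ := l₀) (finish :: w)
      rw [h₂] at this
      simp [run_syncTransducer_cons, syncEntry, hq] at this

/-- Feed the follower the letters that the machine removes until it halts. Then feed it the
remaining queue, on which a halted follower is silent while the leader catches up; on `finish` both
print `mark`. -/
theorem exists_run_eq_of_haltsFrom {c : Q × List A} (h : M.HaltsFrom c) :
    ∃ w, ((M.syncTransducer q₀ l₀).run (track c.1) w).1 = leader ∧
      ((M.syncTransducer q₀ l₀).run leader w).2 =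
        c.2.map sym ++ ((M.syncTransducer q₀ l₀).run (track c.1) w).2 := by
  obtain ⟨d, hd, hh⟩ := h
  induction hd using Relation.ReflTransGen.head_induction_on with
  | refl =>
    have key : ∀ l : List A, (M.syncTransducer q₀ l₀).run (track d.1) (l.map sym ++ [finish]) =
        (leader, [mark]) := fun l => by
      induction l with
      | nil => simp [run_syncTransducer_cons, syncEntry, hh, run]
      | cons a l ih => simp [run_syncTransducer_cons, syncEntry, hh, ih]
    have key' : ∀ l : List A, (M.syncTransducer q₀ l₀).run leader (l.map sym ++ [finish]) =
        (leader, l.map sym ++ [mark]) := fun l => by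
      induction l with
      | nil => simp [run_syncTransducer_cons, syncEntry, run]
      | cons a l ih => simp [run_syncTransducer_cons, syncEntry, ih]
    exact ⟨d.2.map sym ++ [finish], by simp [key, key']⟩
  | @head c e h _ ih =>
    obtain ⟨w, h₁, h₂⟩ := ih
    obtain ⟨q, _ | ⟨a, l⟩⟩ := c
    · simp [next] at h
    · by_cases hq : M.halted q
      · simp [next, hq] at h
      · simp only [Bool.not_eq_true] at hq
        rw [next_cons hq, Option.mem_some_iff] at h
        subst h
        exact ⟨sym a :: w, by
          simpa [run_syncTransducer_cons, syncEntry, hq] using And.intro h₁ h₂⟩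

theorem exists_traceSynchronizes_iff {b : A} (hb : ∀ q, b ∈ (M.step q b).2) (hl₀ : b ∈ l₀) :
    (∃ w, (M.syncTransducer q₀ l₀).TraceSynchronizes w) ↔ M.HaltsFrom (q₀, l₀) := by
  constructor
  · rintro ⟨w, hw⟩
    -- Comparing these two states is enough to extract a halting run.
    have h := hw idle leader
    have hs := finish_notMem_run_leader (M := M) (q₀ := q₀) (l₀ := l₀) w
    have hl := run_leader_fst (M := M) (q₀ := q₀) (l₀ := l₀) w
    rw [← h] at hs hl
    match w with
    | [] => simp [run] at hl
    | sym a :: w => simp [run_syncTransducer_cons, syncEntry] at hs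
    | finish :: w => simp [run_syncTransducer_cons, syncEntry] at hs
    | mark :: w =>
      have h₂ := congrArg Prod.snd h
      simp only [run_syncTransducer_cons, syncEntry] at hl h₂
      exact or_self_iff.1 (haltsFrom_of_run_eq hb hl₀ w q₀ l₀ hl (by simpa using h₂.symm) hl₀)
  · intro h
    obtain ⟨w, h₁, h₂⟩ := exists_run_eq_of_haltsFrom (q₀ := q₀) (l₀ := l₀) h
    -- The initial `mark` makes all non-leader states agree in both state and output.
    have key : ∀ p, (M.syncTransducer q₀ l₀).run p (mark :: w) =
        (M.syncTransducer q₀ l₀).run leader (mark :: w) := by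
      have h₃ := run_leader_fst (M := M) (q₀ := q₀) (l₀ := l₀) w
      rintro (_ | _ | q)
      · rfl
      all_goals
        simp only [run_syncTransducer_cons, syncEntry] at h₁ h₂ h₃ ⊢
        simp [h₁, h₂, h₃]
    exact ⟨mark :: w, fun p q => (key p).trans (key q).symm⟩

end QueueMachine

/-! ### Renaming states and letters, and computable descriptions. -/

namespace SequentialTransducer

variable {Q A B Q' A' B' : Type*} [Finite Q] [Finite A] [Finite B] [Finite Q'] [Finite A']
  [Finite B'] {T : SequentialTransducer Q A B} {T' : SequentialTransducer Q' A' B'}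

theorem run_map (eQ : Q → Q') (eA : A → A') (eB : B → B')
    (h : ∀ q a, T'.step (eQ q) (eA a) = (eQ (T.step q a).1, (T.step q a).2.map eB))
    (q : Q) (w : List A) :
    T'.run (eQ q) (w.map eA) = (eQ (T.run q w).1, (T.run q w).2.map eB) := by
  induction w generalizing q with
  | nil => rfl
  | cons a w ih => simp [run, h, ih]

theorem exists_traceSynchronizes_congr (eQ : Q ≃ Q') (eA : A ≃ A') (eB : B ≃ B')
    (h : ∀ q a, T'.step (eQ q) (eA a) = (eQ (T.step q a).1, (T.step q a).2.map eB)) :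
    (∃ w, T'.TraceSynchronizes w) ↔ ∃ w, T.TraceSynchronizes w := by
  have key : ∀ w, T'.TraceSynchronizes (w.map eA) ↔ T.TraceSynchronizes w := by
    intro w
    simp only [TraceSynchronizes, eQ.surjective.forall, run_map eQ eA eB h, Prod.ext_iff,
      eQ.apply_eq_iff_eq, (List.map_injective_iff.2 eB.injective).eq_iff]
  constructor
  · rintro ⟨w, hw⟩
    refine ⟨w.map eA.symm, (key _).1 ?_⟩
    simpa using hw
  · rintro ⟨w, hw⟩
    exact ⟨_, (key w).2 hw⟩

end SequentialTransducer

/-- The table is a constant except for the flagged entries, to which `u n` is appended. The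
numberings of states and letters are arbitrary but fixed, so choosing them noncomputably does no
harm. -/
theorem exists_primrec_traceSyncTransducer_iff {Q A B : Type} [Finite Q] [Finite A] [Finite B]
    [Nonempty Q] (entry : Q → A → Q × List B × Bool) (u : ℕ → List B)
    (hu : ∀ e : B → ℕ, Primrec fun n => (u n).map e) :
    ∃ d : ℕ → TransducerDescription, Primrec d ∧ ∀ n, TraceSyncTransducer (d n) ↔
      ∃ w, (SequentialTransducer.mk fun q a => ((entry q a).1, (entry q a).2.1 ++
        bif (entry q a).2.2 then u n else []) : SequentialTransducer Q A B).TraceSynchronizes w := by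
  obtain ⟨N, ⟨eQ⟩⟩ := Finite.exists_equiv_fin Q
  obtain ⟨k, ⟨eA⟩⟩ := Finite.exists_equiv_fin A
  obtain ⟨m, ⟨eB⟩⟩ := Finite.exists_equiv_fin B
  let base : List (ℕ × List ℕ × Bool) := List.ofFn fun i : Fin (N * k) =>
    let x := entry (eQ.symm (finProdFinEquiv.symm i).1) (eA.symm (finProdFinEquiv.symm i).2)
    ((eQ x.1 : ℕ), x.2.1.map fun b => (eB b : ℕ), x.2.2)
  let tab (n : ℕ) : List (ℕ × List ℕ) := base.map fun e =>
    (e.1, e.2.1 ++ bif e.2.2 then (u n).map fun b => (eB b : ℕ) else [])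
  have htab : Primrec tab := by
    refine Primrec.list_map (Primrec.const _) (Primrec.pair (Primrec.fst.comp Primrec.snd)
      (Primrec.list_append.comp (Primrec.fst.comp (Primrec.snd.comp Primrec.snd))
        (Primrec.cond (Primrec.snd.comp (Primrec.snd.comp Primrec.snd))
          ((hu _).comp Primrec.fst) (Primrec.const _))))
  have hd : ∀ n, IsTransducerDescription (N, k, m, tab n) := by
    intro n
    refine ⟨Fin.pos (eQ (Classical.arbitrary Q)), by simp [tab, base], ?_⟩
    intro e he
    simp only [tab, base, List.mem_map, List.mem_ofFn] at he
    obtain ⟨_, ⟨i, rfl⟩, rfl⟩ := he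
    refine ⟨Fin.is_lt _, ?_⟩
    intro b hb
    rw [List.mem_append] at hb
    rcases hb with hb | hb
    · obtain ⟨b, -, rfl⟩ := List.mem_map.1 hb
      exact Fin.is_lt _
    · cases h : (entry (eQ.symm (finProdFinEquiv.symm i).1)
        (eA.symm (finProdFinEquiv.symm i).2)).2.2 <;> simp only [h, cond_true, cond_false] at hb
      · simp at hb
      · obtain ⟨b, -, rfl⟩ := List.mem_map.1 hb
        exact Fin.is_lt _
  refine ⟨fun n => ⟨(N, k, m, tab n), hd n⟩, ?_, fun n => ?_⟩
  · exact Primrec.subtype_mk (hp := IsTransducerDescription.primrecPred) ((Primrec.const N).pair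
      ((Primrec.const k).pair ((Primrec.const m).pair htab)))
  · refine SequentialTransducer.exists_traceSynchronizes_congr eQ eA eB fun q a => ?_
    have hi : finProdFinEquiv.symm ⟨(eQ q).1 * k + (eA a).1,
        (TransducerDescription.index_lt ⟨_, hd n⟩ (eQ q) (eA a)).trans_eq (hd n).2.1⟩ =
          (eQ q, eA a) := by
      rw [Equiv.symm_apply_eq]
      ext
      simp [finProdFinEquiv, mul_comm, add_comm]
    have he : TransducerDescription.entry ⟨_, hd n⟩ (eQ q) (eA a) =
        ((eQ (entry q a).1 : ℕ), ((entry q a).2.1 ++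
          bif (entry q a).2.2 then u n else []).map fun b => (eB b : ℕ)) := by
      simp only [TransducerDescription.entry, TransducerDescription.table,
        TransducerDescription.numInputs, tab, base, List.getElem_map, List.getElem_ofFn, hi,
        Equiv.symm_apply_apply]
      cases (entry q a).2.2 <;> simp
    refine Prod.ext (Fin.ext ?_) (List.map_injective_iff.2 Fin.val_injective ?_)
    · exact congrArg Prod.fst he
    · refine Eq.trans ?_ ((congrArg Prod.snd he).trans ?_)
      · simp [TransducerDescription.toTransducer, Function.comp_def]
        rfl
      · simp [Function.comp_def]
        rfl

/-! ### Simulating several stacks on one queue. -/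

open Turing

/-- The letters of a queue holding several stacks: a separator for each stack and the symbols. -/
inductive StackLetter (K Γ : Type*)
  | sep (k : K)
  | sym (γ : Γ)
  deriving DecidableEq

instance StackLetter.finite {K Γ : Type*} [Finite K] [Finite Γ] : Finite (StackLetter K Γ) :=
  Finite.of_surjective (Sum.elim StackLetter.sep StackLetter.sym) (by
    rintro (k | γ)
    exacts [⟨.inl k, rfl⟩, ⟨.inr γ, rfl⟩])

namespace StackLetter

variable {K Γ : Type*}

/-- The word that lists the stacks in the order given by `ks`. -/
def word (ks : List K) (S : K → List Γ) : List (StackLetter K Γ) :=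
  ks.flatMap fun k => sep k :: (S k).map sym

theorem sep_mem_word {ks : List K} {S : K → List Γ} {k : K} : sep k ∈ word ks S ↔ k ∈ ks := by
  simp [word]

theorem word_append (ks ks' : List K) (S : K → List Γ) :
    word (ks ++ ks') S = word ks S ++ word ks' S := List.flatMap_append

theorem word_update [DecidableEq K] {ks : List K} {k : K} (h : k ∉ ks) (S : K → List Γ)
    (x : List Γ) : word ks (Function.update S k x) = word ks S :=
  List.flatMap_congr fun j hj => by rw [Function.update_of_ne (by rintro rfl; exact h hj)]

/-- A rotation of the word of the stacks that starts with a given stack. -/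
theorem exists_word_isRotated [DecidableEq K] [Nontrivial K] {ks : List K} (hks : ks.Nodup)
    (hmem : ∀ k, k ∈ ks) (k : K) (S : K → List Γ) :
    ∃ (k' : K) (r : List (StackLetter K Γ)), sep k ∉ sep k' :: r ∧
      ∀ x, word ks (Function.update S k x) ~r sep k :: (x.map sym ++ sep k' :: r) := by
  obtain ⟨l₁, l₂, rfl⟩ := List.append_of_mem (hmem k)
  have hk : k ∉ l₂ ++ l₁ := by
    simp only [List.nodup_append, List.nodup_cons, List.mem_append] at hks ⊢
    grind
  obtain ⟨k₁, hk₁⟩ := exists_ne k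
  -- With at least two stacks, the contents of stack `k` are followed by another stack's separator,
  -- which signals the bottom.
  obtain ⟨k', l, hl⟩ : ∃ k' l, l₂ ++ l₁ = k' :: l := by
    refine List.exists_cons_of_ne_nil (List.ne_nil_of_mem (a := k₁) ?_)
    have := hmem k₁
    simp only [List.mem_append, List.mem_cons] at this ⊢
    tauto
  have hw : word (l₂ ++ l₁) S = sep k' :: ((S k').map sym ++ word l S) := by
    rw [hl]
    simp [word]
  refine ⟨k', (S k').map sym ++ word l S, ?_, fun x => ?_⟩
  · rw [← hw, sep_mem_word]
    exact hk
  · rw [← hw, ← word_update hk S x, word_append, word_append]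
    refine (List.isRotated_append).trans ?_
    simp [word, List.IsRotated.refl]

end StackLetter

namespace QueueMachine

/-- Every letter in front of `c` is moved to the back. As `c` occurs only once, the resulting
rotation is determined. -/
theorem reaches_rotate {Q A : Type*} {M : QueueMachine Q A} {q : Q} {c : A} {l r : List A}
    (hq : M.halted q = false) (h : l ~r c :: r) (hc : c ∉ r)
    (hrot : ∀ a, a ≠ c → M.step q a = (q, [a])) :
    StateTransition.Reaches M.next (q, l) (q, c :: r) := by
  have key : ∀ x y : List A, c ∉ x →
      StateTransition.Reaches M.next (q, x ++ c :: y) (q, c :: (y ++ x)) := by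
    intro x
    induction x with
    | nil => intro y _; rw [List.nil_append, List.append_nil]; exact .refl
    | cons a x ih =>
      intro y hx
      rw [List.mem_cons, not_or] at hx
      refine .head (b := (q, x ++ c :: (y ++ [a]))) ?_ ?_
      · simp [next_cons hq, hrot a (Ne.symm hx.1)]
      · have := ih (y ++ [a]) hx.2
        rwa [List.append_assoc] at this
  obtain ⟨n, hn, rfl⟩ := List.isRotated_iff_mod.1 h.symm
  cases n with
  | zero => rw [List.rotate_zero]; exact .refl
  | succ n =>
    rw [List.rotate_eq_drop_append_take hn, List.drop_succ_cons, List.take_succ_cons]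
    simpa using key (r.drop n) (r.take n) fun h => hc (List.mem_of_mem_drop h)

end QueueMachine

namespace Turing.TM2

open StackLetter QueueMachine

variable {K Γ Λ σ : Type*} (M : Λ → Stmt (fun _ : K => Γ) Λ σ)

/-- The states of the queue machine that use only statements reachable from the given labels. -/
def queueStates (S : Finset Λ) : Set (Option (Bool × Stmt (fun _ : K => Γ) Λ σ × σ)) :=
  {s | ∀ x ∈ s, some x.2.1 ∈ stmts M S}

theorem finite_queueStates [Finite σ] (S : Finset Λ) : (queueStates M S).Finite := by
  have hf : {q | some q ∈ stmts M S}.Finite :=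
    (stmts M S).finite_toSet.preimage (Option.some_injective _).injOn
  have := (((Set.finite_univ (α := Bool)).prod (hf.prod (Set.finite_univ (α := σ)))).image
    some).insert none
  refine this.subset fun s hs => ?_
  rcases s with _ | ⟨b, q, v⟩
  · exact Or.inl rfl
  · exact Or.inr ⟨_, ⟨trivial, hs _ rfl, trivial⟩, rfl⟩

variable [DecidableEq K] [DecidableEq Γ]

/-- The transition of the queue machine for a machine with stacks. A state consists of a statement,
the internal variable and a flag that tells whether the top of the stack has come to the front of the
queue; there is one further state for halting. -/
def queueStep : Option (Bool × Stmt (fun _ : K => Γ) Λ σ × σ) → StackLetter K Γ →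
    Option (Bool × Stmt (fun _ : K => Γ) Λ σ × σ) × List (StackLetter K Γ)
  | none, a => (none, [a])
  | some (_, .push k f q, v), a =>
    if a = sep k then (some (false, q, v), [a, sym (f v)])
    else (some (false, .push k f q, v), [a])
  | some (true, .peek _ f q, v), sym γ => (some (false, q, f v (some γ)), [sym γ])
  | some (true, .peek _ f q, v), sep k => (some (false, q, f v none), [sep k])
  | some (false, .peek k f q, v), a => (some (decide (a = sep k), .peek k f q, v), [a])
  | some (true, .pop _ f q, v), sym γ => (some (false, q, f v (some γ)), [])
  | some (true, .pop _ f q, v), sep k => (some (false, q, f v none), [sep k])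
  | some (false, .pop k f q, v), a => (some (decide (a = sep k), .pop k f q, v), [a])
  | some (_, .load f q, v), a => (some (false, q, f v), [a])
  | some (_, .branch p q₁ q₂, v), a => (some (false, bif p v then q₁ else q₂, v), [a])
  | some (_, .goto l, v), a => (some (false, M (l v), v), [a])
  | some (_, .halt, _), a => (none, [a])

/-- The queue machine that simulates a machine with stacks. -/
def queueMachine :
    QueueMachine (Option (Bool × Stmt (fun _ : K => Γ) Λ σ × σ)) (StackLetter K Γ) where
  step := queueStep M
  halted := Option.isNone

/-- Separators are always written back; only stack symbols are ever deleted. This keeps the queue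
nonempty, as the synchronization argument requires. -/
theorem sep_mem_queueStep (s : Option (Bool × Stmt (fun _ : K => Γ) Λ σ × σ)) (k : K) :
    sep k ∈ (queueStep M s (sep k)).2 := by
  rcases s with _ | ⟨_ | _, _ | _ | _ | _ | _ | _ | _, v⟩ <;> simp only [queueStep] <;>
    (try split_ifs) <;> simp

theorem queueStep_mem_queueStates [Inhabited Λ] {S : Finset Λ} (hS : Supports M S)
    (s : Option (Bool × Stmt (fun _ : K => Γ) Λ σ × σ)) (hs : s ∈ queueStates M S)
    (a : StackLetter K Γ) : (queueStep M s a).1 ∈ queueStates M S := by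
  have hsome : ∀ (b : Bool) (q : Stmt (fun _ : K => Γ) Λ σ) (v : σ),
      some (b, q, v) ∈ queueStates M S ↔ some q ∈ stmts M S := by
    simp [queueStates]
  have hnone : none ∈ queueStates M S := by simp [queueStates]
  rcases s with _ | ⟨b, q, v⟩
  · exact hnone
  rw [hsome] at hs
  have htr : ∀ q', q' ∈ stmts₁ q → some q' ∈ stmts M S := fun q' h => stmts_trans h hs
  have hsupp := stmts_supportsStmt hS hs
  cases q with
  | push k f q =>
    have := htr q (by simp [stmts₁, stmts₁_self])
    simp only [queueStep]
    split_ifs <;> simpa only [hsome]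
  | peek k f q =>
    have := htr q (by simp [stmts₁, stmts₁_self])
    cases b <;> cases a <;> simpa only [queueStep, hsome]
  | pop k f q =>
    have := htr q (by simp [stmts₁, stmts₁_self])
    cases b <;> cases a <;> simpa only [queueStep, hsome]
  | load f q => simpa only [queueStep, hsome] using htr q (by simp [stmts₁, stmts₁_self])
  | branch p q₁ q₂ =>
    have h₁ := htr q₁ (by simp [stmts₁, stmts₁_self])
    have h₂ := htr q₂ (by simp [stmts₁, stmts₁_self])
    cases h : p v <;> simpa only [queueStep, hsome, h]
  | goto l =>
    simp only [queueStep, hsome]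
    simp only [stmts, Finset.mem_insertNone, Finset.mem_biUnion, Option.mem_def,
      Option.some.injEq, forall_eq']
    exact ⟨_, hsupp v, stmts₁_self⟩
  | halt => exact hnone

/-- The queue holds a rotation of the word of the stacks. -/
def QueueRel (ks : List K) (c : Cfg (fun _ : K => Γ) Λ σ)
    (d : Option (Bool × Stmt (fun _ : K => Γ) Λ σ × σ) × List (StackLetter K Γ)) : Prop :=
  d.1 = c.l.map (fun l => (false, M l, c.var)) ∧ d.2 ~r word ks c.stk

variable {ks : List K}

/-- Induction on the statement. Stack operations first rotate to the separator of `k`. A push writes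
the new symbol just behind the separator at the back; peek and pop pass the separator, set the flag
and inspect the next letter, a top symbol or the next separator. The other statements rotate by one
letter. -/
theorem exists_reaches₁_stepAux [Nontrivial K] (hks : ks.Nodup) (hmem : ∀ k, k ∈ ks)
    (q : Stmt (fun _ : K => Γ) Λ σ) (v : σ) (S : K → List Γ) (w : List (StackLetter K Γ))
    (hw : w ~r word ks S) :
    ∃ d, QueueRel M ks (stepAux q v S) d ∧
      StateTransition.Reaches₁ (queueMachine M).next (some (false, q, v), w) d := by
  have hne : ∀ {w : List (StackLetter K Γ)} {S}, w ~r word ks S → ∃ a l, w = a :: l := fun h => by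
    obtain ⟨k, -⟩ := exists_pair_ne K
    exact List.exists_cons_of_ne_nil (List.ne_nil_of_mem (h.mem_iff.2 (sep_mem_word.2 (hmem k))))
  have rot : ∀ {l : List (StackLetter K Γ)} {a}, l ++ [a] ~r a :: l := fun {l a} =>
    List.isRotated_append
  have hstep : ∀ {b : Bool} {q : Stmt (fun _ : K => Γ) Λ σ} {v : σ} {a : StackLetter K Γ} {l},
      (queueMachine M).next (some (b, q, v), a :: l) =
        some ((queueStep M (some (b, q, v)) a).1, l ++ (queueStep M (some (b, q, v)) a).2) :=
    next_cons rfl _ _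
  induction q generalizing v S w with
  | push k f q ih =>
    obtain ⟨k', r, hk, hr⟩ := exists_word_isRotated hks hmem k S
    have h₀ := hr (S k)
    rw [Function.update_eq_self] at h₀
    obtain ⟨d, hd, h⟩ := ih v (Function.update S k (f v :: S k))
      (((S k).map sym ++ sep k' :: r) ++ [sep k, sym (f v)]) (by
        refine .trans ?_ (hr _).symm
        exact List.isRotated_append)
    refine ⟨d, hd, .trans_right (reaches_rotate rfl (hw.trans h₀) (by simpa using hk) ?_)
      (h.head ?_)⟩
    · intro a ha
      simp [queueMachine, queueStep, ha]
    · simp [hstep, queueStep]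
  | peek k f q ih =>
    obtain ⟨k', r, hk, hr⟩ := exists_word_isRotated hks hmem k S
    have h₀ := hr (S k)
    rw [Function.update_eq_self] at h₀
    have h₁ := reaches_rotate (M := queueMachine M) (q := some (false, .peek k f q, v)) rfl
      (hw.trans h₀) (by simpa using hk) fun a ha => by simp [queueMachine, queueStep, ha]
    cases hS : S k with
    | nil =>
      rw [hS] at h₀ h₁
      obtain ⟨d, hd, h⟩ := ih (f v none) S
        (r ++ [sep k] ++ [sep k']) (by
          refine .trans ?_ h₀.symm
          refine rot.trans ?_
          simpa [hS] using rot (l := sep k' :: r) (a := sep k))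
      refine ⟨d, by simpa [stepAux, hS] using hd, .trans_right h₁ (.head
        (b := (some (true, .peek k f q, v),
        sep k' :: (r ++ [sep k]))) ?_ (h.head ?_))⟩ <;> simp [hstep, queueStep]
    | cons γ t =>
      rw [hS] at h₀ h₁
      obtain ⟨d, hd, h⟩ := ih (f v (some γ)) S
        (t.map sym ++ sep k' :: r ++ [sep k] ++ [sym γ]) (by
          refine .trans ?_ h₀.symm
          refine rot.trans ?_
          have := rot (l := sym γ :: (t.map sym ++ sep k' :: r)) (a := sep k)
          simpa using this)
      refine ⟨d, by simpa [stepAux, hS] using hd, .trans_right h₁ (.head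
        (b := (some (true, .peek k f q, v),
        sym γ :: (t.map sym ++ sep k' :: r ++ [sep k]))) ?_ (h.head ?_))⟩ <;> simp [hstep, queueStep]
  | pop k f q ih =>
    obtain ⟨k', r, hk, hr⟩ := exists_word_isRotated hks hmem k S
    have h₀ := hr (S k)
    rw [Function.update_eq_self] at h₀
    have h₁ := reaches_rotate (M := queueMachine M) (q := some (false, .pop k f q, v)) rfl
      (hw.trans h₀) (by simpa using hk) fun a ha => by simp [queueMachine, queueStep, ha]
    cases hS : S k with
    | nil =>
      rw [hS] at h₀ h₁
      obtain ⟨d, hd, h⟩ := ih (f v none) (Function.update S k (S k).tail)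
        (r ++ [sep k] ++ [sep k']) (by
          refine .trans ?_ (hr _).symm
          refine rot.trans ?_
          simpa [hS] using rot (l := sep k' :: r) (a := sep k))
      refine ⟨d, by simpa [stepAux, hS] using hd, .trans_right h₁ (.head
        (b := (some (true, .pop k f q, v),
        sep k' :: (r ++ [sep k]))) ?_ (h.head ?_))⟩ <;> simp [hstep, queueStep]
    | cons γ t =>
      rw [hS] at h₀ h₁
      obtain ⟨d, hd, h⟩ := ih (f v (some γ)) (Function.update S k (S k).tail)
        (t.map sym ++ sep k' :: r ++ [sep k]) (by
          refine .trans ?_ (hr _).symm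
          have := rot (l := t.map sym ++ sep k' :: r) (a := sep k)
          simpa [hS] using this)
      refine ⟨d, by simpa [stepAux, hS] using hd, .trans_right h₁ (.head
        (b := (some (true, .pop k f q, v),
        sym γ :: (t.map sym ++ sep k' :: r ++ [sep k]))) ?_ (h.head ?_))⟩ <;> simp [hstep, queueStep]
  | load f q ih =>
    obtain ⟨a, l, rfl⟩ := hne hw
    obtain ⟨d, hd, h⟩ := ih (f v) S (l ++ [a]) (rot.trans hw)
    exact ⟨d, hd, h.head (by simp [hstep, queueStep])⟩
  | branch p q₁ q₂ ih₁ ih₂ =>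
    obtain ⟨a, l, rfl⟩ := hne hw
    cases hp : p v
    · obtain ⟨d, hd, h⟩ := ih₂ v S (l ++ [a]) (rot.trans hw)
      exact ⟨d, by simpa [stepAux, hp] using hd, h.head (by simp [hstep, queueStep, hp])⟩
    · obtain ⟨d, hd, h⟩ := ih₁ v S (l ++ [a]) (rot.trans hw)
      exact ⟨d, by simpa [stepAux, hp] using hd, h.head (by simp [hstep, queueStep, hp])⟩
  | goto l =>
    obtain ⟨a, w, rfl⟩ := hne hw
    exact ⟨(some (false, M (l v), v), w ++ [a]), ⟨rfl, rot.trans hw⟩,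
      .single (by simp [hstep, queueStep])⟩
  | halt =>
    obtain ⟨a, w, rfl⟩ := hne hw
    exact ⟨(none, w ++ [a]), ⟨rfl, rot.trans hw⟩, .single (by simp [hstep, queueStep])⟩

theorem respects_queueMachine [Nontrivial K] (hks : ks.Nodup) (hmem : ∀ k, k ∈ ks) :
    StateTransition.Respects (step M) (queueMachine M).next (QueueRel M ks) := by
  rintro ⟨_ | l, v, S⟩ ⟨s, w⟩ ⟨rfl, hw⟩
  · exact next_of_halted rfl w
  · exact exists_reaches₁_stepAux M hks hmem (M l) v S w hw

theorem queueMachine_haltsFrom_iff [Nontrivial K] (hks : ks.Nodup) (hmem : ∀ k, k ∈ ks)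
    (c : Cfg (fun _ : K => Γ) Λ σ) :
    (queueMachine M).HaltsFrom (c.l.map fun l => (false, M l, c.var), word ks c.stk) ↔
      (StateTransition.eval (step M) c).Dom := by
  have hR := respects_queueMachine M hks hmem
  have hc : QueueRel M ks c (c.l.map fun l => (false, M l, c.var), word ks c.stk) :=
    ⟨rfl, .refl _⟩
  constructor
  · rintro ⟨d, hd, hh⟩
    rw [← StateTransition.tr_eval_dom hR hc]
    exact Part.dom_iff_mem.2 ⟨d, StateTransition.mem_eval.2 ⟨hd, next_of_halted hh d.2⟩⟩
  · intro h
    obtain ⟨b, hb⟩ := Part.dom_iff_mem.1 h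
    obtain ⟨d, ⟨hd, -⟩, he⟩ := StateTransition.tr_eval hR hc hb
    refine ⟨d, (StateTransition.mem_eval.1 he).1, ?_⟩
    have hb' := (StateTransition.mem_eval.1 hb).2
    -- A final `TM2` configuration has no label, which corresponds to the halted state `none`.
    obtain ⟨_ | l, v, S⟩ := b
    · simp [hd, queueMachine]
    · simp [step] at hb'

end Turing.TM2

/-! ### Computing the initial queue, and universality. -/

namespace Turing.PartrecToTM2

noncomputable instance Γ'.primcodable : Primcodable Γ' :=
  Primcodable.ofEquiv _ (Fintype.equivFin Γ')

/-- The binary successor, least significant bit first. -/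
def incr (l : List Γ') : List Γ' :=
  List.recOn l [Γ'.bit1] fun b l ih => if b = Γ'.bit0 then Γ'.bit1 :: l else Γ'.bit0 :: ih

theorem trPosNum_succ (p : PosNum) : trPosNum p.succ = incr (trPosNum p) := by
  induction p with
  | one => rfl
  | bit0 p ih => rfl
  | bit1 p ih => simp [PosNum.succ, trPosNum, ih, incr]

theorem trNat_succ (n : ℕ) : trNat (n + 1) = incr (trNat n) := by
  rw [trNat, trNat, Nat.cast_succ, Num.add_one]
  cases (n : Num) with
  | zero => rfl
  | pos p => exact trPosNum_succ p

/-- Binary notation is obtained by iterating the successor `incr`, which is a list recursion. -/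
theorem primrec_trNat : Primrec trNat := by
  have hincr : Primrec incr := by
    refine Primrec.list_rec Primrec.id (Primrec.const _) (Primrec.to₂ <| Primrec.ite
      (Primrec.eq.comp (Primrec.fst.comp Primrec.snd) (Primrec.const _))
      (Primrec.list_cons.comp (Primrec.const _) (Primrec.fst.comp (Primrec.snd.comp Primrec.snd)))
      (Primrec.list_cons.comp (Primrec.const _) (Primrec.snd.comp (Primrec.snd.comp Primrec.snd))))
  refine (Primrec.nat_rec₁ [] (hincr.comp Primrec.snd).to₂).of_eq fun n => ?_
  induction n with
  | zero => simp
  | succ n ih => rw [trNat_succ, ← ih]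

instance : Nontrivial K' := ⟨.main, .rev, by decide⟩

instance : Finite K' :=
  Finite.of_surjective (fun i : Fin 4 => [K'.main, .rev, .aux, .stack].get i) (by
    rintro (_ | _ | _ | _)
    exacts [⟨0, rfl⟩, ⟨1, rfl⟩, ⟨2, rfl⟩, ⟨3, rfl⟩])

end Turing.PartrecToTM2

open Turing Turing.PartrecToTM2 in
/-- The domain of a partial recursive function is the halting set of a finite queue machine, where the
argument determines only the initial queue. -/
theorem exists_queueMachine_haltsFrom_iff {f : ℕ →. ℕ} (hf : Partrec f) :
    ∃ (Q A : Type) (_ : Finite Q) (_ : Finite A) (M : QueueMachine Q A) (q₀ : Q) (b : A)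
      (l₀ : ℕ → List A), (∀ e : A → ℕ, Primrec fun n => (l₀ n).map e) ∧
        (∀ q, b ∈ (M.step q b).2) ∧ (∀ n, b ∈ l₀ n) ∧
        ∀ n, M.HaltsFrom (q₀, l₀ n) ↔ (f n).Dom := by
  obtain ⟨c, hc⟩ := ToPartrec.Code.exists_code (Nat.Partrec'.part_iff₁.2 hf)
  let l := trNormal c Cont'.halt
  let ks := [K'.main, .rev, .aux, .stack]
  -- `TM2.Supports` requires the default label to lie in the support, so the default is the start
  -- label.
  let _ : Inhabited Λ' := ⟨l⟩
  have hS : TM2.Supports tr (codeSupp c Cont'.halt) := tr_supports c Cont'.halt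
  let F := TM2.queueStates tr (codeSupp c Cont'.halt)
  have hF : ∀ s ∈ F, ∀ a, ((TM2.queueMachine tr).step s a).1 ∈ F :=
    TM2.queueStep_mem_queueStates tr hS
  have hl : some (false, tr l, none) ∈ F := by
    rintro x ⟨⟩
    simp only [TM2.stmts, Finset.mem_insertNone, Finset.mem_biUnion, Option.mem_def]
    rintro _ ⟨⟩
    exact ⟨l, hS.1, TM2.stmts₁_self⟩
  refine ⟨F, StackLetter K' Γ', TM2.finite_queueStates tr _, inferInstance,
    (TM2.queueMachine tr).restrict F hF, ⟨_, hl⟩, .sep .main,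
    fun n => StackLetter.word ks (init c [n]).stk, fun e => ?_,
    fun q => TM2.sep_mem_queueStep tr q.1 _,
    fun n => StackLetter.sep_mem_word.2 List.mem_cons_self, fun n => ?_⟩
  -- Initially only the main stack is filled, with the binary digits of `n` and a terminating
  -- `cons`.
  · have : Primrec fun n => e (.sep .main) :: ((trNat n).map (fun γ => e (.sym γ)) ++
        [e (.sym .cons), e (.sep .rev), e (.sep .aux), e (.sep .stack)]) :=
      Primrec.list_cons.comp (Primrec.const _) (Primrec.list_append.comp
        (Primrec.list_map primrec_trNat ((Primrec.dom_finite fun γ => e (.sym γ)).comp Primrec.snd).to₂)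
        (Primrec.const _))
    refine this.of_eq fun n => ?_
    simp [StackLetter.word, ks, init, trList, Function.comp_def]
  · rw [QueueMachine.restrict_haltsFrom]
    refine (TM2.queueMachine_haltsFrom_iff tr (ks := ks) (by decide)
      (by rintro (_ | _ | _ | _) <;> decide) (init c [n])).trans ?_
    rw [tr_eval, show c.eval [n] = pure <$> f n from hc ⟨[n], rfl⟩]
    simp

theorem mainTheorem9 : ¬ ComputablePred TraceSyncTransducer := by
  intro h
  -- The domain of `f` is the set of numbers of the codes that halt on input `0`.
  let f : ℕ →. ℕ := fun n => (Denumerable.ofNat Nat.Partrec.Code n).eval 0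
  have hf : Partrec f :=
    Nat.Partrec.Code.eval_part.comp (Computable.ofNat Nat.Partrec.Code) (Computable.const 0)
  obtain ⟨Q, A, _, _, M, q₀, b, l₀, hprim, hb, hl₀, hM⟩ := exists_queueMachine_haltsFrom_iff hf
  have : Nonempty (SyncState Q) := ⟨.idle⟩
  obtain ⟨d, hd, hsync⟩ := exists_primrec_traceSyncTransducer_iff (M.syncEntry q₀)
    (fun n => (l₀ n).map SyncLetter.sym) fun e => by simpa using hprim (e ∘ SyncLetter.sym)
  refine ComputablePred.halting_problem 0 (ComputablePred.computable_of_manyOneReducible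
    ⟨fun c => d (Encodable.encode c), hd.to_comp.comp Computable.encode, fun c => ?_⟩ h)
  refine Iff.symm ((hsync _).trans (Iff.trans
    (QueueMachine.exists_traceSynchronizes_iff hb (hl₀ _)) ((hM _).trans ?_)))
  simp [f]
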